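/- Work in continuous logic. A real Hilbert space $H$ is regarded as a many-sorted metric structure whose sorts are the balls $B_n(H)$ ($n\ge 1$), with $0$, addition, scalar multiplications and inner product. The language is expanded by a unary function symbol $P$, mapping $B_n(H)$ to $B_n(H)$ and $1$-Lipschitz. Let $T^P$ be the theory of Hilbert spaces together with the axioms $P^2=P$ and $P^*=P$ (Hilbert spaces with an orthogonal projection). Let $T^P_\omega$ be the theory extending $T^P$ that states, for each $k$, that there are $k$ orthonormal vectors $v$ with $P(v)=v$ and $k$ orthonormal vectors $u$ with $P(u)=0$; its models are the pairs $(H,P)$ in which the orthogonal projection $P$ has infinite-dimensional range and infinite-dimensional kernel. (It is also called the theory of beautiful pairs of Hilbert spaces.) Then $T^P_\omega$ is the model companion of $T^P$: every model of $T^P$ embeds into a model of $T^P_\omega$, every model of $T^P_\omega$ embeds into a model of $T^P$, and every embedding between models of $T^P_\omega$ is elementary. Moreover $T^P_\omega$ is $\omega$-stable: for every model $(H,P)$ of $T^P_\omega$, every countable $A\subseteq H$ and every $m$, the space $S_m(A)$ of $m$-types over $A$ is separable in the $d$-metric, where $d(p,q)$ is the infimum of $\max_j\|b_j-b'_j\|$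 over realizations $b$ of $p$ and $b'$ of $q$ in a common model of the theory of $(H,P,a)_{a\in A}$. -/

import Mathlib

/-! Continuous logic for real Hilbert spaces with an extra unary function symbol `P`.

A Hilbert space `H` is viewed as the many-sorted metric structure whose sorts are the balls
`B_n(H)` of radius `n = 1, 2, 3, …`, with the constant `0`, addition, multiplication by each real
number and the inner product. The function symbol `P` maps `B_n(H)` to `B_n(H)` and has modulus of
uniform continuity `Δ(ε) = ε`. The inclusions between the balls are left implicit: terms take values
in `H`, and the sorts appear in the quantifiers, which range over balls. -/

universe u v

noncomputable section

namespace HilbertPair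

/-- Expansions `(H, P)` of real Hilbert spaces to the language with `P`; `P` is not yet assumed to
be a projection. -/
structure Str : Type (u + 1) where
  carrier : Type u
  [normed : NormedAddCommGroup carrier]
  [innerProd : InnerProductSpace ℝ carrier]
  [complete : CompleteSpace carrier]
  P : carrier → carrier
  P_ball : ∀ (n : ℕ+) (x : carrier), ‖x‖ ≤ (n : ℕ) → ‖P x‖ ≤ (n : ℕ)
  P_lipschitz : LipschitzWith 1 P

instance : CoeSort Str.{u} (Type u) := ⟨Str.carrier⟩

attribute [instance] Str.normed Str.innerProd Str.complete

/-- Terms in variables (or constants) from `α`. -/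
inductive Term (α : Type u) : Type u
  | var : α → Term α
  | zero : Term α
  | add : Term α → Term α → Term α
  | smul : ℝ → Term α → Term α
  | proj : Term α → Term α

def Term.realize {α : Type u} (M : Str.{v}) (a : α → M) : Term α → M
  | .var i => a i
  | .zero => 0
  | .add t s => t.realize M a + s.realize M a
  | .smul r t => r • t.realize M a
  | .proj t => M.P (t.realize M a)

/-- Formulas of continuous logic with free variables (or constants) from `α` and from `Fin k`:
the atomic formulas are the metric and the inner product, the connectives are all continuous
functions `ℝ^m → ℝ`, and the quantifiers are the suprema and infima over the sorts. -/
inductive Formula (α : Type u) : ℕ → Type u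
  | dist {k : ℕ} : Term (α ⊕ Fin k) → Term (α ⊕ Fin k) → Formula α k
  | inner {k : ℕ} : Term (α ⊕ Fin k) → Term (α ⊕ Fin k) → Formula α k
  | conn {k m : ℕ} : C(Fin m → ℝ, ℝ) → (Fin m → Formula α k) → Formula α k
  | sup {k : ℕ} : ℕ+ → Formula α (k + 1) → Formula α k
  | inf {k : ℕ} : ℕ+ → Formula α (k + 1) → Formula α k

/-- The value of a formula in `M`. The suprema and infima are over nonempty bounded sets of reals,
see `Formula.bddAbove_range` and `Formula.bddBelow_range`. -/
def Formula.realize {α : Type u} (M : Str.{v}) (a : α → M) :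
    {k : ℕ} → Formula α k → (Fin k → M) → ℝ
  | _, .dist t s, x =>
      Dist.dist (t.realize M (Sum.elim a x)) (s.realize M (Sum.elim a x))
  | _, .inner t s, x =>
      Inner.inner ℝ (t.realize M (Sum.elim a x)) (s.realize M (Sum.elim a x))
  | _, .conn c φ, x => c fun i => (φ i).realize M a x
  | _, .sup n φ, x =>
      ⨆ y : Metric.closedBall (0 : M) (n : ℕ), φ.realize M a (Fin.snoc x (y : M))
  | _, .inf n φ, x =>
      ⨅ y : Metric.closedBall (0 : M) (n : ℕ), φ.realize M a (Fin.snoc x (y : M))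

/-- The value of a formula whose only free variables are those from `α`. -/
def Formula.value {α : Type u} (M : Str.{v}) (a : α → M) (φ : Formula α 0) : ℝ :=
  φ.realize M a Fin.elim0

theorem Term.bounded {α : Type u} (M : Str.{v}) (a : α → M) {k : ℕ} (t : Term (α ⊕ Fin k))
    (R : ℝ) : ∃ C : ℝ, ∀ x : Fin k → M, (∀ i, ‖x i‖ ≤ R) →
      ‖t.realize M (Sum.elim a x)‖ ≤ C := by
  induction t with
  | var i =>
    cases i with
    | inl i => exact ⟨‖a i‖, fun x _ => le_rfl⟩
    | inr i => exact ⟨R, fun x hx => hx i⟩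
  | zero => exact ⟨0, fun x _ => by simp [Term.realize]⟩
  | add t s ht hs =>
    obtain ⟨C, hC⟩ := ht
    obtain ⟨D, hD⟩ := hs
    exact ⟨C + D, fun x hx => (norm_add_le _ _).trans (add_le_add (hC x hx) (hD x hx))⟩
  | smul r t ht =>
    obtain ⟨C, hC⟩ := ht
    exact ⟨‖r‖ * C, fun x hx => by
      rw [Term.realize, norm_smul]
      exact mul_le_mul_of_nonneg_left (hC x hx) (norm_nonneg r)⟩
  | proj t ht =>
    obtain ⟨C, hC⟩ := ht
    refine ⟨((⟨⌈C⌉₊ + 1, Nat.succ_pos _⟩ : ℕ+) : ℕ), fun x hx => M.P_ball _ _ ?_⟩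
    refine (hC x hx).trans ((Nat.le_ceil C).trans ?_)
    exact_mod_cast Nat.le_succ _

/-- Formulas are bounded on bounded sets. -/
theorem Formula.bounded {α : Type u} (M : Str.{v}) (a : α → M) {k : ℕ} (φ : Formula α k) :
    ∀ R : ℝ, ∃ C : ℝ, ∀ x : Fin k → M, (∀ i, ‖x i‖ ≤ R) → |φ.realize M a x| ≤ C := by
  have key : ∀ {k : ℕ} (n : ℕ+) (R : ℝ) (x : Fin k → M), (∀ i, ‖x i‖ ≤ R) →
      ∀ y : Metric.closedBall (0 : M) (n : ℕ), ∀ i : Fin (k + 1),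
        ‖(Fin.snoc x (y : M) : Fin (k + 1) → M) i‖ ≤ max R (n : ℕ) := by
    intro k n R x hx y i
    refine Fin.lastCases ?_ (fun j => ?_) i
    · rw [Fin.snoc_last]
      exact (mem_closedBall_zero_iff.1 y.2).trans (le_max_right _ _)
    · rw [Fin.snoc_castSucc]
      exact (hx j).trans (le_max_left _ _)
  induction φ with
  | dist t s =>
    intro R
    obtain ⟨C, hC⟩ := t.bounded M a R
    obtain ⟨D, hD⟩ := s.bounded M a R
    refine ⟨C + D, fun x hx => ?_⟩
    rw [Formula.realize, abs_of_nonneg dist_nonneg, dist_eq_norm]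
    exact (norm_sub_le _ _).trans (add_le_add (hC x hx) (hD x hx))
  | inner t s =>
    intro R
    obtain ⟨C, hC⟩ := t.bounded M a R
    obtain ⟨D, hD⟩ := s.bounded M a R
    refine ⟨C * D, fun x hx => (abs_real_inner_le_norm _ _).trans ?_⟩
    exact mul_le_mul (hC x hx) (hD x hx) (norm_nonneg _) ((norm_nonneg _).trans (hC x hx))
  | @conn k m c φ ih =>
    intro R
    choose C hC using fun i => ih i R
    obtain ⟨B, hB⟩ := (isCompact_univ_pi fun i : Fin m =>
      isCompact_Icc (a := -C i) (b := C i)).exists_bound_of_continuousOn c.continuous.continuousOn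
    exact ⟨B, fun x hx => hB _ fun i _ => abs_le.1 (hC i x hx)⟩
  | sup n φ ih =>
    intro R
    obtain ⟨C, hC⟩ := ih (max R (n : ℕ))
    have : Nonempty (Metric.closedBall (0 : M) (n : ℕ)) := ⟨⟨0, by simp⟩⟩
    refine ⟨C, fun x hx => ?_⟩
    have h := fun y => abs_le.1 (hC _ (key n R x hx y))
    refine abs_le.2 ⟨?_, ciSup_le fun y => (h y).2⟩
    exact (h ⟨0, by simp⟩).1.trans (le_ciSup ⟨C, by rintro _ ⟨y, rfl⟩; exact (h y).2⟩ _)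
  | inf n φ ih =>
    intro R
    obtain ⟨C, hC⟩ := ih (max R (n : ℕ))
    have : Nonempty (Metric.closedBall (0 : M) (n : ℕ)) := ⟨⟨0, by simp⟩⟩
    refine ⟨C, fun x hx => ?_⟩
    have h := fun y => abs_le.1 (hC _ (key n R x hx y))
    refine abs_le.2 ⟨le_ciInf fun y => (h y).1, ?_⟩
    exact (ciInf_le ⟨-C, by rintro _ ⟨y, rfl⟩; exact (h y).1⟩ _).trans (h ⟨0, by simp⟩).2

theorem Formula.exists_abs_le {α : Type u} (M : Str.{v}) (a : α → M) {k : ℕ} (n : ℕ+)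
    (φ : Formula α (k + 1)) (x : Fin k → M) : ∃ C : ℝ,
      ∀ y : Metric.closedBall (0 : M) (n : ℕ), |φ.realize M a (Fin.snoc x (y : M))| ≤ C := by
  obtain ⟨C, hC⟩ := φ.bounded M a ((∑ i, ‖x i‖) + (n : ℕ))
  refine ⟨C, fun y => hC _ fun i => ?_⟩
  have h0 : 0 ≤ ∑ i, ‖x i‖ := Finset.sum_nonneg fun _ _ => norm_nonneg _
  refine Fin.lastCases ?_ (fun j => ?_) i
  · rw [Fin.snoc_last]
    exact (mem_closedBall_zero_iff.1 y.2).trans (le_add_of_nonneg_left h0)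
  · rw [Fin.snoc_castSucc]
    exact (Finset.single_le_sum (f := fun i => ‖x i‖) (fun _ _ => norm_nonneg _)
      (Finset.mem_univ j)).trans (le_add_of_nonneg_right (Nat.cast_nonneg _))

theorem Formula.bddAbove_range {α : Type u} (M : Str.{v}) (a : α → M) {k : ℕ} (n : ℕ+)
    (φ : Formula α (k + 1)) (x : Fin k → M) :
    BddAbove (Set.range fun y : Metric.closedBall (0 : M) (n : ℕ) =>
      φ.realize M a (Fin.snoc x (y : M))) := by
  obtain ⟨C, hC⟩ := φ.exists_abs_le M a n x
  exact ⟨C, by rintro _ ⟨y, rfl⟩; exact (abs_le.1 (hC y)).2⟩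

theorem Formula.bddBelow_range {α : Type u} (M : Str.{v}) (a : α → M) {k : ℕ} (n : ℕ+)
    (φ : Formula α (k + 1)) (x : Fin k → M) :
    BddBelow (Set.range fun y : Metric.closedBall (0 : M) (n : ℕ) =>
      φ.realize M a (Fin.snoc x (y : M))) := by
  obtain ⟨C, hC⟩ := φ.exists_abs_le M a n x
  exact ⟨-C, by rintro _ ⟨y, rfl⟩; exact (abs_le.1 (hC y)).1⟩

/-! Theories, models, embeddings -/

/-- A theory, on top of the theory of Hilbert spaces: a set of sentences `φ`, each standing for the
condition `φ = 0`. -/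
abbrev Theory : Type := Set (Formula Empty 0)

def Models (M : Str.{u}) (T : Theory) : Prop :=
  ∀ φ ∈ T, φ.value M Empty.elim = 0

/-- Embeddings of structures. -/
structure Emb (M N : Str.{u}) where
  toMap : M →ₗᵢ[ℝ] N
  map_P : ∀ x, toMap (M.P x) = N.P (toMap x)

def Emb.IsElementary {M N : Str.{u}} (f : Emb M N) : Prop :=
  ∀ (k : ℕ) (φ : Formula (Fin k) 0) (a : Fin k → M),
    φ.value N (fun i => f.toMap (a i)) = φ.value M a

/-- A theory is model complete if all embeddings between its models are elementary. -/
def ModelComplete (T : Theory) : Prop :=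
  ∀ M N : Str.{u}, Models M T → Models N T → ∀ f : Emb M N, f.IsElementary

/-- `T'` is a model companion of `T`: models of either theory embed into models of the other one,
and `T'` is model complete. -/
def IsModelCompanion (T T' : Theory) : Prop :=
  (∀ M : Str.{u}, Models M T → ∃ N : Str.{u}, Models N T' ∧ Nonempty (Emb M N)) ∧
  (∀ M : Str.{u}, Models M T' → ∃ N : Str.{u}, Models N T ∧ Nonempty (Emb M N)) ∧
  ModelComplete.{u} T'

/-! Types and stability -/

/-- `(N, c)`, with `c` an interpretation in `N` of the elements of `A`, is a model of the theory
of `(M, a)_{a ∈ A}`. -/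
def ModelsOver (M : Str.{u}) (A : Set M) (N : Str.{u}) (c : A → N) : Prop :=
  ∀ φ : Formula A 0, φ.value N c = φ.value M Subtype.val

/-- The type over `A` of the `m`-tuple `b`: the set of formulas `φ(x)` with parameters from `A`
such that `b` satisfies the condition `φ(x) = 0`. -/
def tp {M : Str.{u}} {A : Set M} {m : ℕ} (N : Str.{u}) (c : A → N) (b : Fin m → N) :
    Set (Formula (A ⊕ Fin m) 0) :=
  {φ | φ.value N (Sum.elim c b) = 0}

/-- The space of `m`-types over `A` (of vectors from all sorts). -/
def typeSpace (M : Str.{u}) (A : Set M) (m : ℕ) : Set (Set (Formula (A ⊕ Fin m) 0)) :=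
  {p | ∃ (N : Str.{u}) (c : A → N), ModelsOver M A N c ∧ ∃ b : Fin m → N, p = tp N c b}

/-- The `d`-metric on types: the infimum of the distances `max_j ‖b_j - b'_j‖` between
realizations `b` of `p` and `b'` of `q` in a common model of the theory of `(M, a)_{a ∈ A}`. -/
def typeDist (M : Str.{u}) (A : Set M) (m : ℕ) (p q : Set (Formula (A ⊕ Fin m) 0)) : ENNReal :=
  sInf {r | ∃ (N : Str.{u}) (c : A → N), ModelsOver M A N c ∧
    ∃ b b' : Fin m → N, tp N c b = p ∧ tp N c b' = q ∧ r = edist b b'}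

/-- `ω`-stability: over countable parameter sets in models of `T`, the type spaces are separable
with respect to the `d`-metric. -/
def OmegaStable (T : Theory) : Prop :=
  ∀ M : Str.{u}, Models M T → ∀ A : Set M, A.Countable → ∀ m : ℕ,
    ∃ D ⊆ typeSpace M A m, D.Countable ∧
      ∀ p ∈ typeSpace M A m, ∀ ε > 0, ∃ q ∈ D, typeDist M A m p q < ε

/-! The theories of Hilbert spaces with a projection -/

/-- The `i`-th bound variable. -/
def bv {k : ℕ} (i : Fin k) : Term (Empty ⊕ Fin k) := .var (.inr i)

/-- The connective `(φ_1, …, φ_m) ↦ |φ_1| + … + |φ_m|`. -/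
def sumAbs {k : ℕ} (m : ℕ) (φ : Fin m → Formula Empty k) : Formula Empty k :=
  .conn ⟨fun r : Fin m → ℝ => ∑ i, |r i|, by fun_prop⟩ φ

/-- `φ - r` for a real number `r`. -/
def subConst {k : ℕ} (φ : Formula Empty k) (r : ℝ) : Formula Empty k :=
  .conn ⟨fun s : Fin 1 → ℝ => s 0 - r, by fun_prop⟩ ![φ]

/-- `|φ - ψ|`. -/
def absSub {k : ℕ} (φ ψ : Formula Empty k) : Formula Empty k :=
  .conn ⟨fun s : Fin 2 → ℝ => |s 0 - s 1|, by fun_prop⟩ ![φ, ψ]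

/-- `inf_{x_1} … inf_{x_k} φ(x_1, …, x_k)`, the variables ranging over the unit ball. -/
def infs : (k : ℕ) → Formula Empty k → Formula Empty 0
  | 0, φ => φ
  | k + 1, φ => infs k (.inf 1 φ)

/-- `P² = P`, on `B_n`: `sup_x ‖P P x - P x‖`. -/
def idempotent (n : ℕ+) : Formula Empty 0 :=
  .sup n (.dist (.proj (.proj (bv 0))) (.proj (bv 0)))

/-- `P* = P`, on `B_n`: `sup_x sup_y |⟨P x, y⟩ - ⟨x, P y⟩|`. -/
def selfAdjoint (n : ℕ+) : Formula Empty 0 :=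
  .sup n (.sup n (absSub (.inner (.proj (bv 0)) (bv 1)) (.inner (bv 0) (.proj (bv 1)))))

/-- `∑_{i,j} |⟨x_i, x_j⟩ - δ_{ij}|`. -/
def orthonormality (k : ℕ) : Formula Empty k :=
  sumAbs k fun i => sumAbs k fun j => subConst (.inner (bv i) (bv j)) (if i = j then 1 else 0)

/-- There are `k` orthonormal vectors `x` with `P x = x`. -/
def fixedVectors (k : ℕ) : Formula Empty 0 :=
  infs k (sumAbs 2 ![orthonormality k, sumAbs k fun i => .dist (.proj (bv i)) (bv i)])

/-- There are `k` orthonormal vectors `x` with `P x = 0`. -/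
def killedVectors (k : ℕ) : Formula Empty 0 :=
  infs k (sumAbs 2 ![orthonormality k, sumAbs k fun i => .dist (.proj (bv i)) .zero])

/-- The theory of Hilbert spaces with a projection. -/
def TP : Theory := Set.range idempotent ∪ Set.range selfAdjoint

/-- The theory of Hilbert spaces with a projection having infinitely many orthonormal vectors
in its range and infinitely many orthonormal vectors in its kernel. -/
def TPω : Theory := TP ∪ Set.range fixedVectors ∪ Set.range killedVectors

end HilbertPair

end

universe w

namespace HilbertPair

open scoped InnerProductSpace


/-! ### Change of parameters and the parameters occurring in a formula -/

/-! The engine is quantifier elimination (`Sim.value_eq`): in models of `TPω` the value of a formula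
at a tuple `a` depends only on the numbers `⟪a i, a j⟫` and `⟪L (a i), a j⟫`, where `L` is the
projection. This is a back-and-forth argument. As `L` is idempotent and symmetric, these numbers
determine all inner products between terms (`Sim.hull`). A finite relation preserving them extends
to any new vector `y` (`Sim.exists_insert`): `L y` and `y - L y` are matched separately in the range
and the kernel of the target, which have room because both are infinite-dimensional. That is exactly
what `TPω` adds to `TP` (`models_TPω_iff`), although its axioms only provide approximate witnesses.

Model completeness follows because the graph of an embedding preserves these numbers. A model of
`TP` embeds into one of `TPω` by adding a copy of ℓ² on which the projection is the identity and
another on which it is zero.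

For ω-stability, modulo the closed span of the parameters and their projections, an `m`-tuple
involves only finitely many orthonormal vectors in the range and finitely many in the kernel
(`exists_isFrame`). The type of a rational combination of such a frame depends only on the
coefficients (`IsFrame.tp_eq`). Over countable `A` there are countably many such types, and they are
dense. -/

def Term.map {α : Type u} {β : Type v} (f : α → β) : Term α → Term β
  | .var i => .var (f i)
  | .zero => .zero
  | .add t s => .add (t.map f) (s.map f)
  | .smul r t => .smul r (t.map f)
  | .proj t => .proj (t.map f)

theorem Term.realize_map {α : Type u} {β : Type v} (f : α → β) (M : Str.{w}) (b : β → M)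
    (t : Term α) : (t.map f).realize M b = t.realize M (b ∘ f) := by
  induction t <;> simp_all [Term.map, Term.realize]

def Formula.map {α : Type u} {β : Type v} (f : α → β) : {k : ℕ} → Formula α k → Formula β k
  | _, .dist t s => .dist (t.map (Sum.map f id)) (s.map (Sum.map f id))
  | _, .inner t s => .inner (t.map (Sum.map f id)) (s.map (Sum.map f id))
  | _, .conn c φ => .conn c fun i => (φ i).map f
  | _, .sup n φ => .sup n (φ.map f)
  | _, .inf n φ => .inf n (φ.map f)

theorem Formula.realize_map {α : Type u} {β : Type v} (f : α → β) (M : Str.{w}) (b : β → M)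
    {k : ℕ} (φ : Formula α k) (x : Fin k → M) :
    (φ.map f).realize M b x = φ.realize M (b ∘ f) x := by
  induction φ <;>
    simp_all [Formula.map, Formula.realize, Term.realize_map, Sum.elim_comp_map]

/-- The variables occurring in a term. -/
def Term.vars {α : Type u} : Term α → Set α
  | .var i => {i}
  | .zero => ∅
  | .add t s => t.vars ∪ s.vars
  | .smul _ t => t.vars
  | .proj t => t.vars

theorem Term.finite_vars {α : Type u} (t : Term α) : t.vars.Finite := by
  induction t <;> simp_all [Term.vars]

/-- The parameters occurring in a formula. -/
def Formula.params {α : Type u} : {k : ℕ} → Formula α k → Set α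
  | _, .dist t s => Sum.inl ⁻¹' (t.vars ∪ s.vars)
  | _, .inner t s => Sum.inl ⁻¹' (t.vars ∪ s.vars)
  | _, .conn _ φ => ⋃ i, (φ i).params
  | _, .sup _ φ => φ.params
  | _, .inf _ φ => φ.params

theorem Formula.finite_params {α : Type u} {k : ℕ} (φ : Formula α k) : φ.params.Finite := by
  induction φ with
  | dist t s =>
    exact (t.finite_vars.union s.finite_vars).preimage Sum.inl_injective.injOn
  | inner t s =>
    exact (t.finite_vars.union s.finite_vars).preimage Sum.inl_injective.injOn
  | conn c φ ih => exact Set.finite_iUnion ih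
  | sup n φ ih => exact ih
  | inf n φ ih => exact ih

/-! ### Values of quantified formulas -/

theorem infs_value_lt_iff (M : Str.{u}) {k : ℕ} (φ : Formula Empty k) (ε : ℝ) :
    (infs k φ).value M Empty.elim < ε ↔
      ∃ x : Fin k → M, (∀ i, ‖x i‖ ≤ 1) ∧ φ.realize M Empty.elim x < ε := by
  induction k with
  | zero =>
    refine ⟨fun h => ⟨Fin.elim0, fun i => i.elim0, h⟩, ?_⟩
    rintro ⟨x, -, h⟩
    rwa [Subsingleton.elim x Fin.elim0] at h
  | succ k ih =>
    have : Nonempty (Metric.closedBall (0 : M) ((1 : ℕ+) : ℕ)) := ⟨⟨0, by simp⟩⟩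
    rw [infs, ih]
    simp only [Formula.realize]
    constructor
    · rintro ⟨x, hx, h⟩
      obtain ⟨y, hy⟩ := exists_lt_of_ciInf_lt h
      refine ⟨_, fun i => ?_, hy⟩
      refine Fin.lastCases ?_ (fun j => ?_) i
      · simpa using y.2
      · simpa using hx j
    · rintro ⟨x, hx, h⟩
      refine ⟨Fin.init x, fun i => hx _, ?_⟩
      refine (ciInf_lt_iff (φ.bddBelow_range M _ 1 _)).2
        ⟨⟨x (Fin.last k), by simpa using hx (Fin.last k)⟩, ?_⟩
      simpa using h

/-- Infima need not be attained, so the axioms of `TPω` yield only witnesses up to every `ε`. -/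
theorem infs_value_eq_zero_iff (M : Str.{u}) {k : ℕ} (φ : Formula Empty k)
    (hφ : ∀ x, 0 ≤ φ.realize M Empty.elim x) :
    (infs k φ).value M Empty.elim = 0 ↔
      ∀ ε > 0, ∃ x : Fin k → M, (∀ i, ‖x i‖ ≤ 1) ∧ φ.realize M Empty.elim x < ε := by
  simp only [← infs_value_lt_iff]
  refine ⟨fun h ε hε => h.trans_lt hε, fun h => ?_⟩
  refine le_antisymm (le_of_forall_gt h) (not_lt.1 fun h0 => ?_)
  obtain ⟨x, -, hx⟩ := (infs_value_lt_iff M φ 0).1 h0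
  exact (hφ x).not_gt hx

theorem Formula.realize_sup_eq_zero_iff {α : Type u} (M : Str.{v}) (a : α → M) {k : ℕ} (n : ℕ+)
    (φ : Formula α (k + 1)) (x : Fin k → M) (hφ : ∀ y, 0 ≤ φ.realize M a y) :
    (Formula.sup n φ).realize M a x = 0 ↔
      ∀ y : M, ‖y‖ ≤ (n : ℕ) → φ.realize M a (Fin.snoc x y) = 0 := by
  have : Nonempty (Metric.closedBall (0 : M) (n : ℕ)) := ⟨⟨0, by simp⟩⟩
  rw [Formula.realize]
  refine ⟨fun h y hy => le_antisymm ?_ (hφ _), fun h => ?_⟩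
  · exact h ▸ le_ciSup (φ.bddAbove_range M a n x) ⟨y, mem_closedBall_zero_iff.2 hy⟩
  · have h' : ∀ y : Metric.closedBall (0 : M) (n : ℕ), φ.realize M a (Fin.snoc x (y : M)) = 0 :=
      fun y => h y (mem_closedBall_zero_iff.1 y.2)
    simp [h']

/-! ### The models of `TP` and of `TPω` -/

/-- The function `P` of `M` is the orthogonal projection `L`. -/
structure Str.IsProj (M : Str.{u}) (L : M →ₗ[ℝ] M) : Prop where
  eq : ∀ x, M.P x = L x
  idem : ∀ x, L (L x) = L x
  symm : ∀ x y, ⟪L x, y⟫_ℝ = ⟪x, L y⟫_ℝ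

theorem exists_pnat_norm_le {E : Type u} [NormedAddCommGroup E] (x : E) :
    ∃ n : ℕ+, ‖x‖ ≤ (n : ℕ) := by
  obtain ⟨n, hn⟩ := exists_nat_ge ‖x‖
  exact ⟨n.succPNat, hn.trans (by simp)⟩

theorem value_idempotent_eq_zero_iff (M : Str.{u}) (n : ℕ+) :
    (idempotent n).value M Empty.elim = 0 ↔ ∀ x : M, ‖x‖ ≤ (n : ℕ) → M.P (M.P x) = M.P x := by
  rw [Formula.value, idempotent, Formula.realize_sup_eq_zero_iff]
  · simp [Formula.realize, Term.realize, bv, Fin.snoc]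
  · intro y
    simp [Formula.realize]

theorem value_selfAdjoint_eq_zero_iff (M : Str.{u}) (n : ℕ+) :
    (selfAdjoint n).value M Empty.elim = 0 ↔ ∀ x : M, ‖x‖ ≤ (n : ℕ) → ∀ y : M, ‖y‖ ≤ (n : ℕ) →
      ⟪M.P x, y⟫_ℝ = ⟪x, M.P y⟫_ℝ := by
  have h0 : ∀ y : Fin 2 → M, 0 ≤ (absSub (.inner (.proj (bv 0)) (bv 1))
      (.inner (bv 0) (.proj (bv 1)))).realize M Empty.elim y := by
    intro y
    simp [Formula.realize, absSub]
  rw [Formula.value, selfAdjoint, Formula.realize_sup_eq_zero_iff]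
  · simp only [Formula.realize_sup_eq_zero_iff _ _ _ _ _ h0]
    simp [Formula.realize, Term.realize, bv, Fin.snoc, absSub, sub_eq_zero]
  · intro y
    have : Nonempty (Metric.closedBall (0 : M) (n : ℕ)) := ⟨⟨0, by simp⟩⟩
    exact Real.iSup_nonneg fun z => h0 _

/-- Linearity of `P` is not an axiom but follows from self-adjointness: moving `P` to the other side
of the inner product leaves an expression linear in the first argument. -/
theorem models_TP_iff (M : Str.{u}) : Models M TP ↔ ∃ L : M →ₗ[ℝ] M, M.IsProj L := by
  have hTP : Models M TP ↔ (∀ x, M.P (M.P x) = M.P x) ∧ ∀ x y, ⟪M.P x, y⟫_ℝ = ⟪x, M.P y⟫_ℝ := by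
    simp only [Models, TP, Set.mem_union, Set.mem_range, or_imp, forall_and,
      forall_exists_index, forall_apply_eq_imp_iff, value_idempotent_eq_zero_iff,
      value_selfAdjoint_eq_zero_iff]
    refine and_congr ⟨fun h x => ?_, fun h n x _ => h x⟩ ⟨fun h x y => ?_, fun h n x _ y _ => h x y⟩
    · obtain ⟨n, hn⟩ := exists_pnat_norm_le x
      exact h n x hn
    · obtain ⟨n, hn⟩ := exists_pnat_norm_le x
      obtain ⟨m, hm⟩ := exists_pnat_norm_le y
      refine h (n + m) x (hn.trans ?_) y (hm.trans ?_) <;> simp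
  rw [hTP]
  constructor
  · rintro ⟨h1, h2⟩
    refine ⟨⟨⟨M.P, fun x y => ext_inner_right ℝ fun z => ?_⟩,
      fun r x => ext_inner_right ℝ fun z => ?_⟩, fun x => rfl, h1, h2⟩
    · simp [h2, inner_add_left]
    · simp [h2, inner_smul_left]
  · rintro ⟨L, hL⟩
    simpa [hL.eq] using ⟨hL.idem, hL.symm⟩

/-- Suppose `∑ c i • y i = 0` and let `S = ∑ c i ^ 2`. Then `∑ c i • x i = -∑ c i • (y i - x i)` has
squared norm at most `S / 4`, while near-orthonormality of `x` makes it at least `S / 2`. Hence `S =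
0`. -/
theorem linearIndependent_of_approx {H : Type u} [NormedAddCommGroup H] [InnerProductSpace ℝ H]
    {k : ℕ} (x y : Fin k → H)
    (hx : ∑ i, ∑ j, |⟪x i, x j⟫_ℝ - if i = j then 1 else 0| < 1 / 2)
    (hy : ∑ i, ‖y i - x i‖ < 1 / 2) : LinearIndependent ℝ y := by
  rw [Fintype.linearIndependent_iff]
  intro c hc
  set S := ∑ i, c i ^ 2 with hS
  have hS0 : 0 ≤ S := Finset.sum_nonneg fun i _ => sq_nonneg _
  have hcS : ∀ i, |c i| ≤ √S := fun i => Real.abs_le_sqrt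
    (Finset.single_le_sum (f := fun i => c i ^ 2) (fun j _ => sq_nonneg _) (Finset.mem_univ i))
  have h1 : ‖∑ i, c i • x i‖ ≤ √S * (1 / 2) := by
    have : ∑ i, c i • x i = - ∑ i, c i • (y i - x i) := by
      simp [smul_sub, Finset.sum_sub_distrib, hc]
    rw [this, norm_neg]
    calc _ ≤ ∑ i, ‖c i • (y i - x i)‖ := norm_sum_le _ _
      _ ≤ ∑ i, √S * ‖y i - x i‖ := Finset.sum_le_sum fun i _ => by
        rw [norm_smul]
        exact mul_le_mul_of_nonneg_right (hcS i) (norm_nonneg _)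
      _ ≤ _ := by
        rw [← Finset.mul_sum]
        exact mul_le_mul_of_nonneg_left hy.le (Real.sqrt_nonneg _)
  have h2 : ‖∑ i, c i • x i‖ ^ 2 =
      S + ∑ i, ∑ j, c i * c j * (⟪x i, x j⟫_ℝ - if i = j then 1 else 0) := by
    rw [← real_inner_self_eq_norm_sq, sum_inner]
    simp [inner_sum, inner_smul_left, inner_smul_right, mul_sub, Finset.sum_sub_distrib, hS, sq,
      mul_assoc, mul_left_comm]
  have h3 : |∑ i, ∑ j, c i * c j * (⟪x i, x j⟫_ℝ - if i = j then 1 else 0)| ≤ S * (1 / 2) := by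
    calc _ ≤ ∑ i, |∑ j, c i * c j * (⟪x i, x j⟫_ℝ - if i = j then 1 else 0)| :=
          Finset.abs_sum_le_sum_abs _ _
      _ ≤ ∑ i, ∑ j, |c i * c j * (⟪x i, x j⟫_ℝ - if i = j then 1 else 0)| :=
          Finset.sum_le_sum fun i _ => Finset.abs_sum_le_sum_abs _ _
      _ ≤ ∑ i, ∑ j, S * |⟪x i, x j⟫_ℝ - if i = j then 1 else 0| := by
          refine Finset.sum_le_sum fun i _ => Finset.sum_le_sum fun j _ => ?_
          rw [abs_mul, abs_mul]
          refine mul_le_mul_of_nonneg_right ?_ (abs_nonneg _)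
          rw [← Real.mul_self_sqrt hS0]
          exact mul_le_mul (hcS i) (hcS j) (abs_nonneg _) (Real.sqrt_nonneg _)
      _ ≤ _ := by
          simp only [← Finset.mul_sum]
          exact mul_le_mul_of_nonneg_left hx.le hS0
  have h4 : ‖∑ i, c i • x i‖ ^ 2 ≤ S * (1 / 4) := by
    refine (pow_le_pow_left₀ (norm_nonneg _) h1 2).trans_eq ?_
    rw [mul_pow, Real.sq_sqrt hS0]
    norm_num
  have h5 : S = 0 := by linarith [abs_le.1 h3]
  intro i
  have := hcS i
  rwa [h5, Real.sqrt_zero, abs_nonpos_iff] at this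

theorem exists_orthonormal_of_not_finiteDimensional {H : Type u} [NormedAddCommGroup H]
    [InnerProductSpace ℝ H] (V : Submodule ℝ H) (hV : ¬ FiniteDimensional ℝ V) (k : ℕ) :
    ∃ x : Fin k → H, Orthonormal ℝ x ∧ ∀ i, x i ∈ V := by
  obtain ⟨f, hf⟩ := exists_linearIndependent_of_le_rank (R := ℝ) (M := V) (n := k)
    (Cardinal.natCast_lt_aleph0.le.trans (not_lt.1 fun h => hV (Module.rank_lt_aleph0_iff.1 h)))
  exact ⟨fun i => (InnerProductSpace.gramSchmidtNormed ℝ f i : V),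
    (InnerProductSpace.gramSchmidtNormed_orthonormal hf).comp_linearIsometry V.subtypeₗᵢ,
    fun i => Subtype.prop _⟩

/-- Treats range and kernel together: `Q` will be `L` or `1 - L`. Approximate witnesses become
independent vectors of `V` once `Q` is applied; conversely, an infinite-dimensional `V` contains
exact witnesses. -/
theorem infs_orthonormality_value_eq_zero_iff (M : Str.{u}) (V : Submodule ℝ M)
    (ψ : (k : ℕ) → Fin k → Formula Empty k) (Q : M → M) (hQ : ∀ x, Q x ∈ V)
    (hψ : ∀ k i (x : Fin k → M), (ψ k i).realize M Empty.elim x = ‖Q (x i) - x i‖)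
    (hV : ∀ x ∈ V, Q x = x) :
    (∀ k, (infs k (sumAbs 2 ![orthonormality k, sumAbs k (ψ k)])).value M Empty.elim = 0) ↔
      ¬ FiniteDimensional ℝ V := by
  have hval : ∀ k (x : Fin k → M),
      (sumAbs 2 ![orthonormality k, sumAbs k (ψ k)]).realize M Empty.elim x =
        ∑ i, ∑ j, |⟪x i, x j⟫_ℝ - if i = j then 1 else 0| + ∑ i, ‖Q (x i) - x i‖ := by
    intro k x
    have h1 : ∀ i : Fin k, 0 ≤ ∑ j, |⟪x i, x j⟫_ℝ - if i = j then 1 else 0| :=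
      fun i => Finset.sum_nonneg fun j _ => abs_nonneg _
    simp only [sumAbs, orthonormality, subConst, Formula.realize, ContinuousMap.coe_mk,
      Fin.sum_univ_two, Matrix.cons_val_zero, Matrix.cons_val_one, hψ, bv, Term.realize,
      Sum.elim_inr, abs_norm]
    rw [abs_of_nonneg (a := ∑ i, ‖Q (x i) - x i‖) (Finset.sum_nonneg fun i _ => norm_nonneg _),
      abs_of_nonneg (Finset.sum_nonneg fun i _ => abs_nonneg _)]
    simp only [abs_of_nonneg (h1 _)]
  have hnn : ∀ k (x : Fin k → M),
      0 ≤ (sumAbs 2 ![orthonormality k, sumAbs k (ψ k)]).realize M Empty.elim x := by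
    intro k x
    rw [hval]
    positivity
  simp only [infs_value_eq_zero_iff _ _ (hnn _), hval]
  constructor
  · intro h hfin
    obtain ⟨x, -, hx⟩ := h (Module.finrank ℝ V + 1) (1 / 2) (by norm_num)
    have h1 : 0 ≤ ∑ i, ∑ j, |⟪x i, x j⟫_ℝ - if i = j then 1 else 0| :=
      Finset.sum_nonneg fun i _ => Finset.sum_nonneg fun j _ => abs_nonneg _
    have h2 : 0 ≤ ∑ i, ‖Q (x i) - x i‖ := Finset.sum_nonneg fun i _ => norm_nonneg _
    have hli := linearIndependent_of_approx x (fun i => Q (x i)) (by linarith) (by linarith)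
    have hli' : LinearIndependent ℝ fun i => (⟨Q (x i), hQ _⟩ : V) :=
      LinearIndependent.of_comp V.subtype hli
    simpa using hli'.fintype_card_le_finrank
  · intro hinf k ε hε
    obtain ⟨x, hx, hxV⟩ := exists_orthonormal_of_not_finiteDimensional V hinf k
    refine ⟨x, fun i => (hx.1 i).le, ?_⟩
    simpa [orthonormal_iff_ite.1 hx, hV _ (hxV _)] using hε

theorem models_TPω_iff {M : Str.{u}} {L : M →ₗ[ℝ] M} (hL : M.IsProj L) :
    Models M TPω ↔ ¬ FiniteDimensional ℝ L.range ∧ ¬ FiniteDimensional ℝ L.ker := by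
  have hTP : ∀ φ ∈ TP, φ.value M Empty.elim = 0 := (models_TP_iff M).2 ⟨L, hL⟩
  rw [← infs_orthonormality_value_eq_zero_iff M L.range
      (fun k i => .dist (.proj (bv i)) (bv i)) L (fun x => ⟨x, rfl⟩),
    ← infs_orthonormality_value_eq_zero_iff M L.ker
      (fun k i => .dist (.proj (bv i)) .zero) (fun x => x - L x)]
  · simp only [Models, TPω, Set.mem_union, Set.mem_range, or_imp, forall_and,
      forall_exists_index, forall_apply_eq_imp_iff, fixedVectors, killedVectors]
    exact ⟨fun h => ⟨h.1.2, h.2⟩, fun h => ⟨⟨hTP, h.1⟩, h.2⟩⟩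
  · intro x
    simp [hL.idem]
  · intro k i x
    simp [Formula.realize, Term.realize, bv, hL.eq]
  · intro x hx
    simpa using hx
  · intro k i x
    simp [Formula.realize, Term.realize, bv, hL.eq, dist_eq_norm]
  · rintro _ ⟨x, rfl⟩
    exact hL.idem x


/-! ### Partial isomorphisms and quantifier elimination -/

section PartialIso

variable {H : Type u} [NormedAddCommGroup H] [InnerProductSpace ℝ H]
  {H' : Type v} [NormedAddCommGroup H'] [InnerProductSpace ℝ H']

/-- Bilinearity, with `B` general so as to cover both the identity and the projection. -/
theorem inner_eq_of_mem_span (B : H →ₗ[ℝ] H) (B' : H' →ₗ[ℝ] H') {R : Set (H × H')}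
    (hR : ∀ p ∈ R, ∀ q ∈ R, ⟪B p.1, q.1⟫_ℝ = ⟪B' p.2, q.2⟫_ℝ) :
    ∀ p ∈ Submodule.span ℝ R, ∀ q ∈ Submodule.span ℝ R,
      ⟪B p.1, q.1⟫_ℝ = ⟪B' p.2, q.2⟫_ℝ := by
  intro p hp q hq
  induction hq using Submodule.span_induction with
  | mem q hq =>
    induction hp using Submodule.span_induction with
    | mem p hp => exact hR p hp q hq
    | zero => simp
    | add p p' _ _ h h' => simp [inner_add_left, h, h']
    | smul r p _ h => simp [inner_smul_left, h]
  | zero => simp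
  | add q q' _ _ h h' => simp [inner_add_right, h, h']
  | smul r q _ h => simp [inner_smul_right, h]

/-- A relation between `H` and `H'` which preserves the inner products `⟪x, y⟫` and `⟪L x, y⟫`. -/
def Sim (L : H →ₗ[ℝ] H) (L' : H' →ₗ[ℝ] H') (R : Set (H × H')) : Prop :=
  ∀ p ∈ R, ∀ q ∈ R, ⟪p.1, q.1⟫_ℝ = ⟪p.2, q.2⟫_ℝ ∧ ⟪L p.1, q.1⟫_ℝ = ⟪L' p.2, q.2⟫_ℝ

variable {L : H →ₗ[ℝ] H} {L' : H' →ₗ[ℝ] H'} {R : Set (H × H')}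

theorem Sim.mono (h : Sim L L' R) {S : Set (H × H')} (hS : S ⊆ R) : Sim L L' S :=
  fun p hp q hq => h p (hS hp) q (hS hq)

theorem Sim.swap (h : Sim L L' R) : Sim L' L (Prod.swap ⁻¹' R) :=
  fun _ hp _ hq => ⟨(h _ hp _ hq).1.symm, (h _ hp _ hq).2.symm⟩

theorem Sim.span (h : Sim L L' R) : Sim L L' (Submodule.span ℝ R) := fun p hp q hq =>
  ⟨inner_eq_of_mem_span .id .id (fun p hp q hq => (h p hp q hq).1) p hp q hq,
    inner_eq_of_mem_span L L' (fun p hp q hq => (h p hp q hq).2) p hp q hq⟩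

theorem Sim.norm_eq (h : Sim L L' R) {p : H × H'} (hp : p ∈ R) : ‖p.1‖ = ‖p.2‖ := by
  have := (h p hp p hp).1
  rw [real_inner_self_eq_norm_sq, real_inner_self_eq_norm_sq] at this
  exact (pow_left_inj₀ (norm_nonneg _) (norm_nonneg _) two_ne_zero).1 this

theorem Sim.dist_eq (h : Sim L L' R) {p q : H × H'} (hp : p ∈ R) (hq : q ∈ R) :
    dist p.1 q.1 = dist p.2 q.2 := by
  rw [dist_eq_norm, dist_eq_norm]
  exact h.span.norm_eq (Submodule.sub_mem _ (Submodule.subset_span hp) (Submodule.subset_span hq))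

/-- The closure of a relation under linear combinations and under `(L, L')`, for idempotent
`L` and `L'`. -/
def hull (L : H →ₗ[ℝ] H) (L' : H' →ₗ[ℝ] H') (R : Set (H × H')) : Submodule ℝ (H × H') :=
  Submodule.span ℝ (R ∪ L.prodMap L' '' R)

theorem subset_hull : R ⊆ hull L L' R := fun _ hp => Submodule.subset_span (.inl hp)

theorem map_mem_hull_of_mem {p : H × H'} (hp : p ∈ R) : (L p.1, L' p.2) ∈ hull L L' R :=
  Submodule.subset_span (.inr ⟨p, hp, rfl⟩)

end PartialIso

/-- If `W` is finite-dimensional and `V` is not then `V` contains a unit vector orthogonal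
to `W`. -/
theorem exists_unit_mem_orthogonal {H : Type u} [NormedAddCommGroup H] [InnerProductSpace ℝ H]
    (V W : Submodule ℝ H) (hV : ¬ FiniteDimensional ℝ V) [FiniteDimensional ℝ W] :
    ∃ z ∈ V, ‖z‖ = 1 ∧ z ∈ Wᗮ := by
  -- A map from an infinite-dimensional space to a finite-dimensional one has a kernel; the vector
  -- sought is a normalized kernel element.
  have hni : ¬ Function.Injective (W.orthogonalProjectionOnto.toLinearMap ∘ₗ V.subtype) :=
    fun h => hV (FiniteDimensional.of_injective _ h)
  rw [← LinearMap.ker_eq_bot, Submodule.eq_bot_iff] at hni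
  push Not at hni
  obtain ⟨z, hz, hz0⟩ := hni
  have hz0' : (z : H) ≠ 0 := by simpa using hz0
  refine ⟨‖(z : H)‖⁻¹ • (z : H), V.smul_mem _ z.2, norm_smul_inv_norm hz0', Wᗮ.smul_mem _ ?_⟩
  exact Submodule.orthogonalProjectionOnto_eq_zero_iff.1 (by simpa using hz)

/-- Extension of finite partial isometries into an infinite-dimensional space. -/
theorem exists_inner_eq {H : Type u} [NormedAddCommGroup H] [InnerProductSpace ℝ H]
    {H' : Type v} [NormedAddCommGroup H'] [InnerProductSpace ℝ H'] {R : Set (H × H')}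
    (hfin : R.Finite) (hR : ∀ p ∈ R, ∀ q ∈ R, ⟪p.1, q.1⟫_ℝ = ⟪p.2, q.2⟫_ℝ)
    (V : Submodule ℝ H') (hRV : ∀ p ∈ R, p.2 ∈ V) (hV : ¬ FiniteDimensional ℝ V) (y : H) :
    ∃ z ∈ V, ⟪z, z⟫_ℝ = ⟪y, y⟫_ℝ ∧ ∀ p ∈ R, ⟪z, p.2⟫_ℝ = ⟪y, p.1⟫_ℝ := by
  have hE : FiniteDimensional ℝ (Submodule.span ℝ R) := FiniteDimensional.span_of_finite ℝ hfin
  have hsp := inner_eq_of_mem_span .id .id hR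
  simp only [LinearMap.id_apply] at hsp
  set E := Submodule.span ℝ R
  have hEV : ∀ p ∈ E, p.2 ∈ V := by
    have : E ≤ V.comap (LinearMap.snd ℝ H H') := Submodule.span_le.2 hRV
    exact this
  -- `p.1` is the orthogonal projection of `y` to the span of the first coordinates, and `p.2` is
  -- its partner in `H'`.
  obtain ⟨p, hp, hpy⟩ := Submodule.mem_map.1
    ((E.map (LinearMap.fst ℝ H H')).starProjection_apply_mem y)
  have hort := (E.map (LinearMap.fst ℝ H H')).sub_starProjection_mem_orthogonal y
  rw [← hpy, LinearMap.fst_apply] at hort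
  have hort' : ∀ q ∈ E, ⟪y - p.1, q.1⟫_ℝ = 0 := fun q hq =>
    Submodule.inner_left_of_mem_orthogonal (Submodule.mem_map_of_mem hq) hort
  obtain ⟨e, heV, he1, he⟩ :=
    exists_unit_mem_orthogonal V (E.map (LinearMap.snd ℝ H H')) hV
  have he' : ∀ q ∈ E, ⟪e, q.2⟫_ℝ = 0 := fun q hq =>
    Submodule.inner_left_of_mem_orthogonal (Submodule.mem_map_of_mem hq) he
  -- The residue `y - p.1` is replaced by a vector of equal length in the fresh direction `e`.
  refine ⟨p.2 + ‖y - p.1‖ • e, V.add_mem (hEV p hp) (V.smul_mem _ heV), ?_, fun q hq => ?_⟩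
  · have h1 : ⟪y, y⟫_ℝ = ⟪p.1, p.1⟫_ℝ + ‖y - p.1‖ ^ 2 := by
      rw [← real_inner_self_eq_norm_sq]
      have := hort' p hp
      simp only [inner_sub_left, inner_sub_right, real_inner_comm p.1 y] at this ⊢
      linarith
    rw [h1, hsp p hp p hp]
    have h2 := he' p hp
    have h3 : ⟪p.2, e⟫_ℝ = 0 := by rw [real_inner_comm, h2]
    have h4 : ⟪e, e⟫_ℝ = 1 := by rw [real_inner_self_eq_norm_sq, he1, one_pow]
    simp only [inner_add_left, inner_add_right, inner_smul_left, inner_smul_right, h2, h3, h4]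
    simp [sq]
  · have hqE : q ∈ E := Submodule.subset_span hq
    have := hort' q hqE
    rw [inner_sub_left, sub_eq_zero] at this
    rw [this, inner_add_left, inner_smul_left, he' q hqE, hsp p hp q hqE]
    simp

/-! ### Back-and-forth between models of `TPω` -/

section Str

variable {M : Str.{u}} {N : Str.{v}} {L : M →ₗ[ℝ] M} {K : N →ₗ[ℝ] N} {R : Set (M × N)}

theorem map_mem_hull (hL : M.IsProj L) (hK : N.IsProj K) {p : M × N} (hp : p ∈ hull L K R) :
    (L p.1, K p.2) ∈ hull L K R := by
  have : hull L K R ≤ (hull L K R).comap (L.prodMap K) := by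
    refine Submodule.span_le.2 ?_
    rintro _ (hp | ⟨p, hp, rfl⟩)
    · exact map_mem_hull_of_mem hp
    · simpa [hL.idem, hK.idem] using map_mem_hull_of_mem hp
  exact this hp

/-- Idempotence and symmetry reduce every inner product of generators involving `L` to the form `⟪L
p, q⟫`. -/
theorem Sim.hull (h : Sim L K R) (hL : M.IsProj L) (hK : N.IsProj K) :
    Sim L K (hull L K R) := by
  refine Sim.span ?_
  rintro _ (hp | ⟨p, hp, rfl⟩) _ (hq | ⟨q, hq, rfl⟩)
  · exact h _ hp _ hq
  · simpa [← hL.symm, ← hK.symm, hL.idem, hK.idem] using (h _ hp _ hq).2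
  · simpa [hL.idem, hK.idem] using (h _ hp _ hq).2
  · simpa [← hL.symm, ← hK.symm, hL.idem, hK.idem] using (h _ hp _ hq).2

theorem Sim.insert (h : Sim L K R) (hL : M.IsProj L) (hK : N.IsProj K) {y : M} {z : N}
    (hyz : ⟪y, y⟫_ℝ = ⟪z, z⟫_ℝ) (hLyz : ⟪L y, y⟫_ℝ = ⟪K z, z⟫_ℝ)
    (hR : ∀ p ∈ R, ⟪y, p.1⟫_ℝ = ⟪z, p.2⟫_ℝ ∧ ⟪L y, p.1⟫_ℝ = ⟪K z, p.2⟫_ℝ) :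
    Sim L K (Insert.insert (y, z) R) := by
  rintro p (rfl | hp) q (rfl | hq)
  · exact ⟨hyz, hLyz⟩
  · exact hR q hq
  · obtain ⟨h1, h2⟩ := hR p hp
    refine ⟨by simpa [real_inner_comm] using h1, ?_⟩
    rw [hL.symm, hK.symm, real_inner_comm, h2, real_inner_comm]
  · exact h p hp q hq

/-- The one-point extension. The images `z₁` of `L y` in the range and `z₀` of `y - L y` in the
kernel are chosen independently; they are orthogonal, so `z₁ + z₀` has the right inner products. -/
theorem Sim.exists_insert (h : Sim L K R) (hfin : R.Finite) (hL : M.IsProj L) (hK : N.IsProj K)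
    (hN : Models N TPω) (y : M) : ∃ z, Sim L K (Insert.insert (y, z) R) := by
  obtain ⟨hN1, hN0⟩ := (models_TPω_iff hK).1 hN
  have hh := h.hull hL hK
  obtain ⟨z₁, hz₁, hzz₁, hzR₁⟩ := exists_inner_eq (hfin.image (L.prodMap K))
    (by
      rintro _ ⟨p, hp, rfl⟩ _ ⟨q, hq, rfl⟩
      exact (hh _ (map_mem_hull_of_mem hp) _ (map_mem_hull_of_mem hq)).1)
    K.range (by rintro _ ⟨p, hp, rfl⟩; exact ⟨p.2, rfl⟩) hN1 (L y)
  obtain ⟨z₀, hz₀, hzz₀, hzR₀⟩ := exists_inner_eq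
    (hfin.image fun p => (p.1 - L p.1, p.2 - K p.2))
    (by
      rintro _ ⟨p, hp, rfl⟩ _ ⟨q, hq, rfl⟩
      exact (hh _ (sub_mem (subset_hull hp) (map_mem_hull_of_mem hp))
        _ (sub_mem (subset_hull hq) (map_mem_hull_of_mem hq))).1)
    K.ker (by rintro _ ⟨p, hp, rfl⟩; simp [hK.idem]) hN0 (y - L y)
  have hKz₁ : K z₁ = z₁ := by
    obtain ⟨x, rfl⟩ := hz₁
    exact hK.idem x
  have hKz₀ : K z₀ = 0 := hz₀
  have h10 : ⟪z₁, z₀⟫_ℝ = 0 := by rw [← hKz₁, hK.symm, hKz₀, inner_zero_right]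
  have h01 : ⟪z₀, z₁⟫_ℝ = 0 := by rw [real_inner_comm, h10]
  have hLyy : ⟪L y, L y⟫_ℝ = ⟪L y, y⟫_ℝ := by rw [← hL.symm, hL.idem]
  have hyLy : ⟪y, L y⟫_ℝ = ⟪L y, y⟫_ℝ := (hL.symm y y).symm
  simp only [Set.forall_mem_image, LinearMap.prodMap_apply] at hzR₁ hzR₀
  have key1 : ∀ p ∈ R, ⟪L y, p.1⟫_ℝ = ⟪z₁, p.2⟫_ℝ := fun p hp => by
    have := hzR₁ hp
    rw [← hK.symm, hKz₁, ← hL.symm, hL.idem] at this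
    exact this.symm
  have key0 : ∀ p ∈ R, ⟪y - L y, p.1⟫_ℝ = ⟪z₀, p.2⟫_ℝ := fun p hp => by
    have := hzR₀ hp
    rw [inner_sub_right, ← hK.symm, hKz₀, inner_zero_left, sub_zero, inner_sub_right,
      ← hL.symm, map_sub, hL.idem, sub_self, inner_zero_left, sub_zero] at this
    exact this.symm
  refine ⟨z₁ + z₀, h.insert hL hK ?_ ?_ fun p hp => ⟨?_, ?_⟩⟩
  · simp only [inner_sub_left, inner_sub_right] at hzz₀
    rw [inner_add_left, inner_add_right, inner_add_right, h10, h01, hzz₁, hzz₀]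
    linarith
  · rw [map_add, hKz₁, hKz₀, add_zero, inner_add_right, h10, add_zero, hzz₁, hLyy]
  · rw [inner_add_left, ← key1 p hp, ← key0 p hp, ← inner_add_left, add_sub_cancel]
  · rw [map_add, hKz₁, hKz₀, add_zero, key1 p hp]

theorem Term.realize_mem_hull (hL : M.IsProj L) (hK : N.IsProj K) {α : Type w} (t : Term α)
    (a : α → M) (b : α → N) (hab : ∀ i ∈ t.vars, (a i, b i) ∈ R) :
    (t.realize M a, t.realize N b) ∈ hull L K R := by
  induction t with
  | var i => exact subset_hull (hab i rfl)
  | zero => exact zero_mem _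
  | add t s ht hs =>
    exact add_mem (ht fun i hi => hab i (.inl hi)) (hs fun i hi => hab i (.inr hi))
  | smul r t ht => exact Submodule.smul_mem _ r (ht hab)
  | proj t ht =>
    simp only [Term.realize, hL.eq, hK.eq]
    exact map_mem_hull hL hK (ht hab)

theorem mem_of_mem_sumElim {α : Type w} {k : ℕ} {a : α → M} {b : α → N} {x : Fin k → M}
    {y : Fin k → N} {V : Set (α ⊕ Fin k)} (hab : ∀ i ∈ Sum.inl ⁻¹' V, (a i, b i) ∈ R)
    (hxy : ∀ i, (x i, y i) ∈ R) : ∀ i ∈ V, (Sum.elim a x i, Sum.elim b y i) ∈ R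
  | .inl i, hi => hab i hi
  | .inr i, _ => hxy i

theorem snoc_mem_insert {k : ℕ} {x : Fin k → M} {y : Fin k → N} (hxy : ∀ i, (x i, y i) ∈ R)
    (s : M) (t : N) (i : Fin (k + 1)) :
    ((Fin.snoc x s : Fin (k + 1) → M) i, (Fin.snoc y t : Fin (k + 1) → N) i) ∈
      Insert.insert (s, t) R := by
  refine Fin.lastCases ?_ (fun j => ?_) i
  · simp
  · simpa using .inr (hxy j)

/-- Induction on `φ` with `R` varying. At a quantifier, extending `R` both ways within the ball
shows that the two models produce the same set of values, hence the same supremum or infimum. -/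
theorem Sim.realize_eq_of_finite (hL : M.IsProj L) (hK : N.IsProj K) (hM : Models M TPω)
    (hN : Models N TPω) {α : Type w} (a : α → M) (b : α → N) {k : ℕ} (φ : Formula α k) :
    ∀ (R : Set (M × N)), R.Finite → Sim L K R → (∀ i ∈ φ.params, (a i, b i) ∈ R) →
      ∀ (x : Fin k → M) (y : Fin k → N), (∀ i, (x i, y i) ∈ R) →
        φ.realize M a x = φ.realize N b y := by
  have forth : ∀ {R : Set (M × N)}, R.Finite → Sim L K R → ∀ (n : ℕ+)
      (s : Metric.closedBall (0 : M) (n : ℕ)), ∃ t : Metric.closedBall (0 : N) (n : ℕ),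
        Sim L K (Insert.insert (s.1, t.1) R) := by
    intro R hfin hR n s
    obtain ⟨t, ht⟩ := hR.exists_insert hfin hL hK hN s
    refine ⟨⟨t, ?_⟩, ht⟩
    exact mem_closedBall_zero_iff.2 ((ht.norm_eq (Set.mem_insert _ _)).symm.trans_le
      (mem_closedBall_zero_iff.1 s.2))
  have back : ∀ {R : Set (M × N)}, R.Finite → Sim L K R → ∀ (n : ℕ+)
      (t : Metric.closedBall (0 : N) (n : ℕ)), ∃ s : Metric.closedBall (0 : M) (n : ℕ),
        Sim L K (Insert.insert (s.1, t.1) R) := by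
    intro R hfin hR n t
    obtain ⟨s, hs⟩ := hR.swap.exists_insert (hfin.preimage Prod.swap_injective.injOn) hK hL hM t
    have hs' : Sim L K (Insert.insert (s, t.1) R) := hs.swap.mono (by
      rintro p (rfl | hp)
      · exact .inl rfl
      · exact .inr (by simpa using hp))
    refine ⟨⟨s, ?_⟩, hs'⟩
    exact mem_closedBall_zero_iff.2 ((hs'.norm_eq (Set.mem_insert _ _)).trans_le
      (mem_closedBall_zero_iff.1 t.2))
  induction φ with
  | dist t s =>
    intro R hfin hR hab x y hxy
    have h := mem_of_mem_sumElim hab hxy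
    exact (hR.hull hL hK).dist_eq
      (t.realize_mem_hull hL hK _ _ fun i hi => h i (.inl hi))
      (s.realize_mem_hull hL hK _ _ fun i hi => h i (.inr hi))
  | inner t s =>
    intro R hfin hR hab x y hxy
    have h := mem_of_mem_sumElim hab hxy
    exact ((hR.hull hL hK) _ (t.realize_mem_hull hL hK _ _ fun i hi => h i (.inl hi)) _
      (s.realize_mem_hull hL hK _ _ fun i hi => h i (.inr hi))).1
  | conn c φ ih =>
    intro R hfin hR hab x y hxy
    simp only [Formula.realize]
    congr 1
    ext i
    exact ih i R hfin hR (fun j hj => hab j (Set.mem_iUnion.2 ⟨i, hj⟩)) x y hxy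
  | sup n φ ih =>
    intro R hfin hR hab x y hxy
    simp only [Formula.realize]
    refine congrArg sSup (Set.ext fun r => ⟨?_, ?_⟩)
    · rintro ⟨s, rfl⟩
      obtain ⟨t, ht⟩ := forth hfin hR n s
      exact ⟨t, (ih _ (hfin.insert _) ht (fun i hi => .inr (hab i hi)) _ _
        (snoc_mem_insert hxy _ _)).symm⟩
    · rintro ⟨t, rfl⟩
      obtain ⟨s, hs⟩ := back hfin hR n t
      exact ⟨s, ih _ (hfin.insert _) hs (fun i hi => .inr (hab i hi)) _ _
        (snoc_mem_insert hxy _ _)⟩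
  | inf n φ ih =>
    intro R hfin hR hab x y hxy
    simp only [Formula.realize]
    refine congrArg sInf (Set.ext fun r => ⟨?_, ?_⟩)
    · rintro ⟨s, rfl⟩
      obtain ⟨t, ht⟩ := forth hfin hR n s
      exact ⟨t, (ih _ (hfin.insert _) ht (fun i hi => .inr (hab i hi)) _ _
        (snoc_mem_insert hxy _ _)).symm⟩
    · rintro ⟨t, rfl⟩
      obtain ⟨s, hs⟩ := back hfin hR n t
      exact ⟨s, ih _ (hfin.insert _) hs (fun i hi => .inr (hab i hi)) _ _
        (snoc_mem_insert hxy _ _)⟩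

/-- Quantifier elimination: the values of formulas in models of `TPω` are determined by the inner
products `⟪a i, a j⟫` and `⟪L (a i), a j⟫`. -/
theorem Sim.value_eq (hR : Sim L K R) (hL : M.IsProj L) (hK : N.IsProj K) (hM : Models M TPω)
    (hN : Models N TPω) {α : Type w} {a : α → M} {b : α → N} (hab : ∀ i, (a i, b i) ∈ R)
    (φ : Formula α 0) : φ.value M a = φ.value N b := by
  -- A formula has only finitely many parameters, so a finite part of `R` suffices.
  refine Sim.realize_eq_of_finite hL hK hM hN a b φ ((fun i => (a i, b i)) '' φ.params)
    (φ.finite_params.image _) (hR.mono ?_) (fun i hi => ⟨i, hi, rfl⟩) _ _ fun i => i.elim0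
  rintro _ ⟨i, -, rfl⟩
  exact hab i

end Str


/-! ### The model companion -/

theorem modelComplete_TPω : ModelComplete.{u} TPω := by
  intro M N hM hN f k φ a
  obtain ⟨L, hL⟩ := (models_TP_iff M).1 fun φ hφ => hM φ (.inl (.inl hφ))
  obtain ⟨K, hK⟩ := (models_TP_iff N).1 fun φ hφ => hN φ (.inl (.inl hφ))
  have hsim : Sim L K (Set.range fun x => (x, f.toMap x)) := by
    rintro _ ⟨x, rfl⟩ _ ⟨y, rfl⟩
    simp [← hL.eq, ← hK.eq, ← f.map_P]
  exact (hsim.value_eq hL hK hM hN (fun i => ⟨a i, rfl⟩) φ).symm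

/-- A Hilbert space with an orthogonal projection. -/
def Str.ofProj (H : Type u) [NormedAddCommGroup H] [InnerProductSpace ℝ H] [CompleteSpace H]
    (L : H →ₗ[ℝ] H) (hid : ∀ x, L (L x) = L x) (hs : ∀ x y, ⟪L x, y⟫_ℝ = ⟪x, L y⟫_ℝ) : Str.{u} :=
  have hnorm : ∀ x, ‖L x‖ ≤ ‖x‖ := fun x => by
    -- Cauchy–Schwarz applied to `⟪L x, L x⟫ = ⟪x, L x⟫`.
    have h : ‖L x‖ * ‖L x‖ ≤ ‖L x‖ * ‖x‖ := by
      rw [← real_inner_self_eq_norm_mul_norm, ← hs, hid]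
      exact real_inner_le_norm _ _
    rcases (norm_nonneg (L x)).eq_or_lt with h0 | h0
    · exact h0 ▸ norm_nonneg x
    · exact le_of_mul_le_mul_left h h0
  { carrier := H
    P := L
    P_ball := fun n x hx => (hnorm x).trans hx
    P_lipschitz := LipschitzWith.of_dist_le_mul fun x y => by
      simpa [dist_eq_norm] using hnorm (x - y) }

theorem not_finiteDimensional_of_orthonormal {H : Type u} [NormedAddCommGroup H]
    [InnerProductSpace ℝ H] {V : Submodule ℝ H} {x : ℕ → H} (hx : Orthonormal ℝ x)
    (hV : ∀ i, x i ∈ V) : ¬ FiniteDimensional ℝ V := fun _ =>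
  have hli : LinearIndependent ℝ fun i => (⟨x i, hV i⟩ : V) :=
    LinearIndependent.of_comp V.subtype hx.linearIndependent
  not_finite_iff_infinite.2 inferInstance hli.finite

/-- The direct sum of `H` with two infinite-dimensional Hilbert spaces. -/
abbrev Ampliation (H : Type u) : Type u :=
  WithLp 2 (H × WithLp 2 (lp (fun _ : ℕ => ℝ) 2 × lp (fun _ : ℕ => ℝ) 2))

/-- The direct sum of `L` with the identity and with `0`. -/
noncomputable def ampliation {H : Type u} [NormedAddCommGroup H] [InnerProductSpace ℝ H]
    (L : H →ₗ[ℝ] H) : Ampliation H →ₗ[ℝ] Ampliation H where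
  toFun x := .toLp 2 (L x.fst, .toLp 2 (x.snd.fst, 0))
  map_add' x y := by simp [← WithLp.toLp_add]
  map_smul' r x := by
    simp only [RingHom.id_apply, ← WithLp.toLp_smul, Prod.smul_mk]
    simp

section Ampliation

variable {H : Type u} [NormedAddCommGroup H] [InnerProductSpace ℝ H] {L : H →ₗ[ℝ] H}

theorem ampliation_apply (x : Ampliation H) :
    ampliation L x = .toLp 2 (L x.fst, .toLp 2 (x.snd.fst, 0)) :=
  rfl

theorem ampliation_symm (hs : ∀ x y, ⟪L x, y⟫_ℝ = ⟪x, L y⟫_ℝ) (x y : Ampliation H) :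
    ⟪ampliation L x, y⟫_ℝ = ⟪x, ampliation L y⟫_ℝ := by
  simp [ampliation_apply, WithLp.prod_inner_apply, hs]

theorem not_finiteDimensional_range_ampliation : ¬ FiniteDimensional ℝ (ampliation L).range := by
  let b : HilbertBasis ℕ ℝ (lp (fun _ : ℕ => ℝ) 2) := default
  refine not_finiteDimensional_of_orthonormal (x := fun i => .toLp 2 (0, .toLp 2 (b i, 0))) ?_
    fun i => ⟨.toLp 2 (0, .toLp 2 (b i, 0)), by simp [ampliation_apply]⟩
  rw [orthonormal_iff_ite]
  intro i j
  simp [WithLp.prod_inner_apply, orthonormal_iff_ite.1 b.orthonormal]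

theorem not_finiteDimensional_ker_ampliation : ¬ FiniteDimensional ℝ (ampliation L).ker := by
  let b : HilbertBasis ℕ ℝ (lp (fun _ : ℕ => ℝ) 2) := default
  refine not_finiteDimensional_of_orthonormal (x := fun i => .toLp 2 (0, .toLp 2 (0, b i))) ?_
    fun i => by simp [ampliation_apply]
  rw [orthonormal_iff_ite]
  intro i j
  simp [WithLp.prod_inner_apply, orthonormal_iff_ite.1 b.orthonormal]

variable (H) in
/-- The inclusion of `H` in its ampliation. -/
noncomputable def inclusion : H →ₗᵢ[ℝ] Ampliation H where
  toFun x := .toLp 2 (x, 0)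
  map_add' x y := by simp [← WithLp.toLp_add]
  map_smul' r x := by simp [← WithLp.toLp_smul]
  norm_map' x := by simp

end Ampliation

theorem exists_emb_models_TPω (M : Str.{u}) (hM : Models M TP) :
    ∃ N : Str.{u}, Models N TPω ∧ Nonempty (Emb M N) := by
  obtain ⟨L, hL⟩ := (models_TP_iff M).1 hM
  have hid : ∀ x, ampliation L (ampliation L x) = ampliation L x := fun x => by
    simp [ampliation_apply, hL.idem]
  have hs := ampliation_symm hL.symm
  have hK : (Str.ofProj (Ampliation M) (ampliation L) hid hs).IsProj (ampliation L) :=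
    ⟨fun x => rfl, hid, hs⟩
  refine ⟨_, (models_TPω_iff hK).2
    ⟨not_finiteDimensional_range_ampliation, not_finiteDimensional_ker_ampliation⟩,
    ⟨⟨inclusion M, fun x => ?_⟩⟩⟩
  exact congrArg (fun y => inclusion M y) (hL.eq x)

theorem isModelCompanion_TPω : IsModelCompanion.{u} TP TPω :=
  ⟨exists_emb_models_TPω, fun M hM => ⟨M, fun φ hφ => hM φ (.inl (.inl hφ)), ⟨⟨.id, fun _ => rfl⟩⟩⟩,
    modelComplete_TPω⟩

/-! ### Stability -/

section Stability

variable {M : Str.{u}} {A : Set M} {N : Str.{u}} {c : A → N}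

theorem ModelsOver.models (h : ModelsOver M A N c) {T : Theory} (hM : Models M T) :
    Models N T := by
  intro φ hφ
  have := h (φ.map Empty.elim)
  rw [Formula.value, Formula.value, Formula.realize_map, Formula.realize_map] at this
  rwa [Subsingleton.elim (c ∘ Empty.elim) Empty.elim,
    Subsingleton.elim (Subtype.val ∘ Empty.elim) Empty.elim, ← Formula.value, ← Formula.value,
    hM φ hφ] at this

theorem ModelsOver.sim {L : M →ₗ[ℝ] M} {K : N →ₗ[ℝ] N} (hL : M.IsProj L) (hK : N.IsProj K)
    (h : ModelsOver M A N c) (a b : A) :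
    ⟪c a, c b⟫_ℝ = ⟪(a : M), b⟫_ℝ ∧ ⟪K (c a), c b⟫_ℝ = ⟪L a, b⟫_ℝ := by
  have h1 := h (.inner (.var (.inl a)) (.var (.inl b)))
  have h2 := h (.inner (.proj (.var (.inl a))) (.var (.inl b)))
  simp only [Formula.value, Formula.realize, Term.realize, Sum.elim_inl, hL.eq, hK.eq] at h1 h2
  exact ⟨h1, h2⟩

/-- The vectors `e₁` and `e₀` of `N` are orthonormal and orthogonal to the `c a`, the vectors `e₁`
are in the range of the projection and the vectors `e₀` are in its kernel. -/
structure IsFrame (N : Str.{u}) {ι : Type v} (c : ι → N) {d₁ d₀ : ℕ} (e₁ : Fin d₁ → N)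
    (e₀ : Fin d₀ → N) : Prop where
  orthonormal₁ : Orthonormal ℝ e₁
  orthonormal₀ : Orthonormal ℝ e₀
  map₁ : ∀ i, N.P (e₁ i) = e₁ i
  map₀ : ∀ i, N.P (e₀ i) = 0
  inner₁ : ∀ i a, ⟪e₁ i, c a⟫_ℝ = 0
  inner₀ : ∀ i a, ⟪e₀ i, c a⟫_ℝ = 0

/-- The vectors `c a`, `P (c a)`, `e₁ i` and `e₀ i`. -/
def frame {N : Str.{u}} {ι : Type v} (c : ι → N) {d₁ d₀ : ℕ} (e₁ : Fin d₁ → N)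
    (e₀ : Fin d₀ → N) : (ι ⊕ ι) ⊕ (Fin d₁ ⊕ Fin d₀) → N :=
  Sum.elim (Sum.elim c fun a => N.P (c a)) (Sum.elim e₁ e₀)

/-- Linear combinations with rational coefficients. -/
noncomputable def ratComb {N : Type u} [AddCommGroup N] [Module ℝ N] {κ : Type v} (v : κ → N)
    (x : κ →₀ ℚ) : N :=
  Finsupp.linearCombination ℝ v (x.mapRange ((↑) : ℚ → ℝ) Rat.cast_zero)

/-- By density of `ℚ` and continuity of the operations, the closure of the rational combinations is
closed under addition and real scaling. -/
theorem mem_closure_range_ratComb {H : Type u} [NormedAddCommGroup H] [InnerProductSpace ℝ H]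
    {κ : Type v} (v : κ → H) {x : H}
    (hx : x ∈ (Submodule.span ℝ (Set.range v)).topologicalClosure) :
    x ∈ closure (Set.range (ratComb v)) := by
  refine closure_minimal (fun x hx => ?_) isClosed_closure hx
  have hadd : ∀ x y, ratComb v (x + y) = ratComb v x + ratComb v y := fun x y => by
    rw [ratComb, Finsupp.mapRange_add Rat.cast_add, map_add, ratComb, ratComb]
  have hsmul : ∀ (q : ℚ) x, (q : ℝ) • ratComb v x ∈ Set.range (ratComb v) := fun q x => by
    refine ⟨q • x, ?_⟩
    rw [ratComb, ratComb, ← map_smul]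
    congr 1
    ext i
    simp
  induction hx using Submodule.span_induction with
  | mem x hx =>
    obtain ⟨k, rfl⟩ := hx
    exact subset_closure ⟨Finsupp.single k 1, by simp [ratComb]⟩
  | zero => exact subset_closure ⟨0, by simp [ratComb]⟩
  | add x y _ _ hx hy =>
    refine map_mem_closure₂ continuous_add hx hy ?_
    rintro _ ⟨x, rfl⟩ _ ⟨y, rfl⟩
    exact ⟨x + y, hadd x y⟩
  | smul r x _ hx =>
    refine map_mem_closure₂ continuous_smul (Rat.denseRange_cast r) hx ?_
    rintro _ ⟨q, rfl⟩ _ ⟨x, rfl⟩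
    exact hsmul q x

theorem ratComb_mem_span {H : Type u} [AddCommGroup H] [Module ℝ H] {H' : Type v}
    [AddCommGroup H'] [Module ℝ H'] {κ : Type w} (v : κ → H) (v' : κ → H') (x : κ →₀ ℚ) :
    (ratComb v x, ratComb v' x) ∈ Submodule.span ℝ (Set.range fun k => (v k, v' k)) := by
  rw [Finsupp.mem_span_range_iff_exists_finsupp]
  refine ⟨x.mapRange ((↑) : ℚ → ℝ) Rat.cast_zero, ?_⟩
  simp only [ratComb, Finsupp.linearCombination_apply, Finsupp.sum]
  ext <;> simp [Prod.fst_sum, Prod.snd_sum]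

/-- The type of a tuple of rational linear combinations of a frame depends only on the
coefficients. -/
theorem IsFrame.tp_eq (hM : Models M TPω) {N' : Str.{u}} {c' : A → N'}
    (h : ModelsOver M A N c) (h' : ModelsOver M A N' c') {d₁ d₀ m : ℕ}
    {e₁ : Fin d₁ → N} {e₀ : Fin d₀ → N} (he : IsFrame N c e₁ e₀)
    {e₁' : Fin d₁ → N'} {e₀' : Fin d₀ → N'} (he' : IsFrame N' c' e₁' e₀')
    (x : Fin m → ((A ⊕ A) ⊕ (Fin d₁ ⊕ Fin d₀)) →₀ ℚ) :
    tp N c (fun j => ratComb (frame c e₁ e₀) (x j)) =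
      tp N' c' (fun j => ratComb (frame c' e₁' e₀') (x j)) := by
  have hN := h.models hM
  have hN' := h'.models hM
  obtain ⟨L, hL⟩ := (models_TP_iff M).1 fun φ hφ => hM φ (.inl (.inl hφ))
  obtain ⟨K, hK⟩ := (models_TP_iff N).1 fun φ hφ => hN φ (.inl (.inl hφ))
  obtain ⟨K', hK'⟩ := (models_TP_iff N').1 fun φ hφ => hN' φ (.inl (.inl hφ))
  set R : Set (N × N') := Set.range (fun a => (c a, c' a)) ∪
    (Set.range (fun i => (e₁ i, e₁' i)) ∪ Set.range (fun i => (e₀ i, e₀' i)))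
  have hsim : Sim K K' R := by
    have hc : ∀ a b, ⟪c a, c b⟫_ℝ = ⟪c' a, c' b⟫_ℝ ∧ ⟪K (c a), c b⟫_ℝ = ⟪K' (c' a), c' b⟫_ℝ :=
      fun a b => ⟨(h.sim hL hK a b).1.trans (h'.sim hL hK' a b).1.symm,
        (h.sim hL hK a b).2.trans (h'.sim hL hK' a b).2.symm⟩
    have h1 := he.map₁
    have h1' := he'.map₁
    have h0 := he.map₀
    have h0' := he'.map₀
    simp only [hK.eq, hK'.eq] at h1 h1' h0 h0'
    have i1 := fun a i => (real_inner_comm _ _).trans (he.inner₁ i a)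
    have i0 := fun a i => (real_inner_comm _ _).trans (he.inner₀ i a)
    have i1' := fun a i => (real_inner_comm _ _).trans (he'.inner₁ i a)
    have i0' := fun a i => (real_inner_comm _ _).trans (he'.inner₀ i a)
    have h10 : ∀ i j, ⟪e₁ i, e₀ j⟫_ℝ = 0 := fun i j => by
      rw [← h1, hK.symm, h0, inner_zero_right]
    have h10' : ∀ i j, ⟪e₁' i, e₀' j⟫_ℝ = 0 := fun i j => by
      rw [← h1', hK'.symm, h0', inner_zero_right]
    have h01 := fun i j => (real_inner_comm _ _).trans (h10 i j)
    have h01' := fun i j => (real_inner_comm _ _).trans (h10' i j)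
    have o1 := orthonormal_iff_ite.1 he.orthonormal₁
    have o0 := orthonormal_iff_ite.1 he.orthonormal₀
    have o1' := orthonormal_iff_ite.1 he'.orthonormal₁
    have o0' := orthonormal_iff_ite.1 he'.orthonormal₀
    rintro _ (⟨a, rfl⟩ | ⟨i, rfl⟩ | ⟨i, rfl⟩) _ (⟨b, rfl⟩ | ⟨j, rfl⟩ | ⟨j, rfl⟩)
    · exact hc a b
    · simp [i1, i1', hK.symm, hK'.symm, h1, h1']
    · simp [i0, i0', hK.symm, hK'.symm, h0, h0']
    · simp [he.inner₁, he'.inner₁, h1, h1']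
    · simp [o1, o1', h1, h1']
    · simp [h10, h10', h1, h1']
    · simp [he.inner₀, he'.inner₀, h0, h0']
    · simp [h01, h01', h0, h0']
    · simp [o0, o0', h0, h0']
  have hspan : Submodule.span ℝ (Set.range fun k => (frame c e₁ e₀ k, frame c' e₁' e₀' k)) ≤
      hull K K' R := by
    refine Submodule.span_le.2 ?_
    rintro _ ⟨(a | a) | (i | i), rfl⟩
    · exact subset_hull (.inl ⟨a, rfl⟩)
    · simp only [frame, Sum.elim_inl, Sum.elim_inr, hK.eq, hK'.eq]
      exact map_mem_hull_of_mem (p := (c a, c' a)) (.inl ⟨a, rfl⟩)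
    · exact subset_hull (.inr (.inl ⟨i, rfl⟩))
    · exact subset_hull (.inr (.inr ⟨i, rfl⟩))
  ext φ
  simp only [tp, Set.mem_ofPred_eq]
  rw [(hsim.hull hK hK').value_eq hK hK' hN hN']
  rintro (a | j)
  · exact subset_hull (.inl ⟨a, rfl⟩)
  · exact hspan (ratComb_mem_span _ _ _)

theorem exists_orthonormal_range_eq_span {H : Type u} [NormedAddCommGroup H]
    [InnerProductSpace ℝ H] {m : ℕ} (r : Fin m → H) :
    ∃ (d : ℕ) (e : Fin d → H), Orthonormal ℝ e ∧
      Submodule.span ℝ (Set.range e) = Submodule.span ℝ (Set.range r) := by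
  set F := Submodule.span ℝ (Set.range r)
  have : FiniteDimensional ℝ F := FiniteDimensional.span_of_finite ℝ (Set.finite_range r)
  let b := stdOrthonormalBasis ℝ F
  refine ⟨_, fun i => (b i : H), b.orthonormal.comp_linearIsometry F.subtypeₗᵢ, ?_⟩
  have := congrArg (Submodule.map F.subtype) b.toBasis.span_eq
  rw [Submodule.map_span, ← Set.range_comp, Submodule.map_top, Submodule.range_subtype] at this
  simpa [Function.comp_def] using this

/-- Every tuple in a model is in the closed span of a frame. -/
theorem exists_isFrame {L : N →ₗ[ℝ] N} (hL : N.IsProj L) {m : ℕ} (b : Fin m → N) :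
    ∃ (d₁ d₀ : ℕ) (e₁ : Fin d₁ → N) (e₀ : Fin d₀ → N), IsFrame N c e₁ e₀ ∧
      ∀ j, b j ∈ (Submodule.span ℝ (Set.range (frame c e₁ e₀))).topologicalClosure := by
  set G := Submodule.span ℝ (Set.range (Sum.elim c fun a => N.P (c a)))
  have : CompleteSpace G.topologicalClosure :=
    G.isClosed_topologicalClosure.completeSpace_coe
  -- The residues are orthogonal to each `c a` and `P (c a)`, so by symmetry of `L` both `L (r j)`
  -- and `r j - L (r j)` are orthogonal to each `c a`. Orthonormal bases of their spans form the
  -- frame.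
  set r : Fin m → N := fun j => b j - G.topologicalClosure.starProjection (b j)
  have hr : ∀ j, r j ∈ Gᗮ := fun j => by
    rw [← G.orthogonal_closure]
    exact Submodule.sub_starProjection_mem_orthogonal _
  have hrc : ∀ j a, ⟪r j, c a⟫_ℝ = 0 := fun j a =>
    Submodule.inner_left_of_mem_orthogonal
      (Submodule.subset_span (Set.mem_range.2 ⟨.inl a, rfl⟩)) (hr j)
  have hrLc : ∀ j a, ⟪r j, L (c a)⟫_ℝ = 0 := fun j a =>
    Submodule.inner_left_of_mem_orthogonal
      (Submodule.subset_span (Set.mem_range.2 ⟨.inr a, hL.eq _⟩)) (hr j)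
  obtain ⟨d₁, e₁, he₁, hs₁⟩ := exists_orthonormal_range_eq_span fun j => L (r j)
  obtain ⟨d₀, e₀, he₀, hs₀⟩ := exists_orthonormal_range_eq_span fun j => r j - L (r j)
  have mem₁ : ∀ V : Submodule ℝ N, (∀ j, L (r j) ∈ V) → ∀ i, e₁ i ∈ V := fun V hV i =>
    Submodule.span_le.2 (Set.range_subset_iff.2 hV)
      (hs₁ ▸ Submodule.subset_span (Set.mem_range_self i))
  have mem₀ : ∀ V : Submodule ℝ N, (∀ j, r j - L (r j) ∈ V) → ∀ i, e₀ i ∈ V := fun V hV i =>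
    Submodule.span_le.2 (Set.range_subset_iff.2 hV)
      (hs₀ ▸ Submodule.subset_span (Set.mem_range_self i))
  refine ⟨d₁, d₀, e₁, e₀, ⟨he₁, he₀, fun i => ?_, fun i => ?_, fun i a => ?_, fun i a => ?_⟩,
    fun j => ?_⟩
  · rw [hL.eq]
    exact mem₁ (LinearMap.eqLocus L .id) (fun j => hL.idem _) i
  · rw [hL.eq]
    exact mem₀ L.ker (fun j => by simp [hL.idem]) i
  · exact Submodule.mem_orthogonal_singleton_iff_inner_left.1
      (mem₁ (Submodule.span ℝ {c a})ᗮ (fun j => by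
        rw [Submodule.mem_orthogonal_singleton_iff_inner_left, hL.symm, hrLc]) i)
  · exact Submodule.mem_orthogonal_singleton_iff_inner_left.1
      (mem₀ (Submodule.span ℝ {c a})ᗮ (fun j => by
        rw [Submodule.mem_orthogonal_singleton_iff_inner_left, inner_sub_left, hL.symm, hrLc,
          hrc, sub_zero]) i)
  · set V := Submodule.span ℝ (Set.range (frame c e₁ e₀))
    have hGV : G ≤ V := Submodule.span_mono
      (Set.range_subset_iff.2 fun k => ⟨.inl k, rfl⟩)
    have h1 : Submodule.span ℝ (Set.range e₁) ≤ V := Submodule.span_mono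
      (Set.range_subset_iff.2 fun k => ⟨.inr (.inl k), rfl⟩)
    have h0 : Submodule.span ℝ (Set.range e₀) ≤ V := Submodule.span_mono
      (Set.range_subset_iff.2 fun k => ⟨.inr (.inr k), rfl⟩)
    rw [hs₁] at h1
    rw [hs₀] at h0
    have hrV : r j ∈ V := by
      have := add_mem (h1 (Submodule.subset_span ⟨j, rfl⟩)) (h0 (Submodule.subset_span ⟨j, rfl⟩))
      simpa using this
    have hb : b j = r j + G.topologicalClosure.starProjection (b j) := by simp [r]
    rw [hb]
    exact add_mem (V.le_topologicalClosure hrV)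
      (Submodule.topologicalClosure_mono hGV (Submodule.starProjection_apply_mem _ _))

theorem omegaStable_TPω : OmegaStable.{u} TPω := by
  intro M hM A hA m
  have := hA.to_subtype
  -- An index records the frame size and the rational coefficients, so `I` is countable. Each `D x`
  -- has at most one element and may be empty.
  let I := Σ d : ℕ × ℕ, Fin m → ((A ⊕ A) ⊕ (Fin d.1 ⊕ Fin d.2)) →₀ ℚ
  let D : I → Set (Set (Formula (A ⊕ Fin m) 0)) := fun x =>
    {p | ∃ (N : Str.{u}) (c : A → N), ModelsOver M A N c ∧ ∃ e₁ e₀, IsFrame N c e₁ e₀ ∧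
      p = tp N c fun j => ratComb (frame c e₁ e₀) (x.2 j)}
  refine ⟨⋃ x, D x, ?_, Set.countable_iUnion fun x => Set.Subsingleton.countable ?_, ?_⟩
  · rintro p hp
    obtain ⟨x, N, c, hc, e₁, e₀, -, rfl⟩ := Set.mem_iUnion.1 hp
    exact ⟨N, c, hc, _, rfl⟩
  · rintro _ ⟨N, c, hc, e₁, e₀, he, rfl⟩ _ ⟨N', c', hc', e₁', e₀', he', rfl⟩
    exact he.tp_eq hM hc hc' he' x.2
  · rintro _ ⟨N, c, hc, b, rfl⟩ ε hε
    obtain ⟨L, hL⟩ := (models_TP_iff N).1 fun φ hφ => hc.models hM φ (.inl (.inl hφ))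
    obtain ⟨d₁, d₀, e₁, e₀, he, hb⟩ := exists_isFrame (c := c) hL b
    obtain ⟨δ, hδ0, hδ⟩ := exists_between hε
    have happ : ∀ j, ∃ x, edist (b j) (ratComb (frame c e₁ e₀) x) < δ := fun j => by
      obtain ⟨_, ⟨x, rfl⟩, hx⟩ :=
        EMetric.mem_closure_iff.1 (mem_closure_range_ratComb _ (hb j)) δ hδ0
      exact ⟨x, hx⟩
    choose x hx using happ
    refine ⟨_, Set.mem_iUnion.2 ⟨⟨(d₁, d₀), x⟩, N, c, hc, e₁, e₀, he, rfl⟩, ?_⟩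
    -- The tuple and its approximation lie in the same `N`, which therefore serves as the common
    -- model.
    refine lt_of_le_of_lt (sInf_le ⟨N, c, hc, _, _, rfl, rfl, rfl⟩) (lt_of_le_of_lt ?_ hδ)
    exact edist_pi_le_iff.2 fun j => (hx j).le

end Stability

end HilbertPair


theorem mainTheorem9 :
    HilbertPair.IsModelCompanion.{u} HilbertPair.TP HilbertPair.TPω ∧
      HilbertPair.OmegaStable.{u} HilbertPair.TPω :=
  ⟨HilbertPair.isModelCompanion_TPω, HilbertPair.omegaStable_TPω⟩
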